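/- All graphs are finite and simple. For positive integers $a_1,\dots,a_s$ write $G \overset{v}{\rightarrow} (a_1,\dots,a_s)$ if for every coloring of the vertices of $G$ in $s$ colors there is an $i\in\{1,\dots,s\}$ such that $G$ contains an $a_i$-clique all of whose vertices have color $i$. Let $\mathcal H(a_1,\dots,a_s;q)$ be the set of graphs $G$ with $G \overset{v}{\rightarrow} (a_1,\dots,a_s)$ and clique number $\omega(G)<q$, and let $F_v(a_1,\dots,a_s;q)$ be the least number of vertices of a graph in $\mathcal H(a_1,\dots,a_s;q)$; a graph in this set with exactly that number of vertices is called extremal. Let $(2_r,p)$ denote $(2,\dots,2,p)$ with $r$ twos before $p$. **Theorem.** Let $p\ge 2$ be an integer. For every $r\ge 2$ the number $F_v(2_r,p;r+p-1)$ exists (that is, $\mathcal H(2_r,p;r+p-1)\neq\emptyset$), and $\min_{r\ge 2}\{F_v(2_r,p;r+p-1)-r\}$ is attained. Let $r_0=r_0(p)$ be the smallest integer $r_0\ge 2$ for which $$\min_{r\ge 2}\{F_v(2_r,p;r+p-1)-r\}=F_v(2_{r_0},p;r_0+p-1)-r_0 .$$ Then: (a) $F_v(2_r,p;r+p-1)=F_v(2_{r_0},p;r_0+p-1)+r-r_0$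 for all $r\ge r_0$. (b) If $r_0=2$, then $F_v(2_r,p;r+p-1)=F_v(2,2,p;p+1)+r-2$ for all $r\ge 2$. (c) If $r_0>2$ and $G$ is an extremal graph in $\mathcal H(2_{r_0},p;r_0+p-1)$, then $G\overset{v}{\rightarrow}(2,r_0+p-2)$. (d) $r_0<F_v(2,2,p;p+1)-2p$. In particular, for $p=5$ we have $r_0(5)\le 5$. -/

import Mathlib

namespace Folkman

/-- The vertex arrow relation `G → (a₁, …, aₛ)`: for every colouring of the vertices of `G` in `s`
colours there are a colour `i` and an `aᵢ`-clique of `G` all of whose vertices have colour `i`. -/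
def Arrows {V : Type*} (G : SimpleGraph V) (a : List ℕ) : Prop :=
  ∀ c : V → Fin a.length, ∃ i : Fin a.length, ∃ S : Finset V,
    G.IsNClique (a.get i) S ∧ ∀ v ∈ S, c v = i

/-- The finite graph `G` belongs to `H(a₁, …, aₛ; q)`: `G → (a₁, …, aₛ)` and `ω(G) < q`. -/
def InH {V : Type*} [Fintype V] (G : SimpleGraph V) (a : List ℕ) (q : ℕ) : Prop :=
  Arrows G a ∧ G.cliqueNum < q

/-- The orders of the graphs in `H(a₁, …, aₛ; q)`. -/
def orders (a : List ℕ) (q : ℕ) : Set ℕ :=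
  {n | ∃ G : SimpleGraph (Fin n), InH G a q}

/-- The vertex Folkman number `F_v(a₁, …, aₛ; q)`, the least order of a graph in
`H(a₁, …, aₛ; q)`. (It is meaningful when `orders a q` is nonempty.) -/
noncomputable def Fv (a : List ℕ) (q : ℕ) : ℕ := sInf (orders a q)

/-- `G` is an extremal graph in `H(a₁, …, aₛ; q)`. -/
def IsExtremal {V : Type*} [Fintype V] (G : SimpleGraph V) (a : List ℕ) (q : ℕ) : Prop :=
  InH G a q ∧ Fintype.card V = Fv a q

/-- The tuple `(2_r, p) = (2, …, 2, p)` with `r` entries equal to `2` before the entry `p`. -/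
def twos (r p : ℕ) : List ℕ := List.replicate r 2 ++ [p]

/-- The integers `r ≥ 2` at which the minimum over all `s ≥ 2` of
`F_v(2_s, p; s + p - 1) - s` exists and is attained. -/
def minimizers (p : ℕ) : Set ℕ :=
  {r | 2 ≤ r ∧
    IsLeast ((fun s : ℕ => (Fv (twos s p) (s + p - 1) : ℤ) - s) '' {s | 2 ≤ s})
      ((Fv (twos r p) (r + p - 1) : ℤ) - r)}

/-- The number `r₀(p)`, the smallest minimizer. -/
noncomputable def r₀ (p : ℕ) : ℕ := sInf (minimizers p)

end Folkman

/-! Write F(r) for F_v(2_r, p; r+p-1). Joining a new vertex to everything raises both the number of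
twos and the clique bound by one (`Arr.cone`), so F(r+1) ≤ F(r) + 1 and F(r) - r never increases. It
is positive, so it attains a minimum, and it is constant from the first minimizer on: this gives (a)
and (b). Existence comes from an amalgamation that adds a two while keeping ω ≤ p (`amalgam_arr`).

For (c), minimality of r₀ > 2 gives F(r₀) ≤ F(r₀ - 1). If an extremal G failed to arrow (2, r₀+p-2),
deleting an independent set that meets all (r₀+p-2)-cliques would leave a smaller graph counted by
F(r₀ - 1), a contradiction.

For (d), `Arr.card_ge` pairs a maximum clique with outside vertices by non-edges and uses the pairs
as colour classes. Applied to an extremal G with k = r₀+p-2, it gives F(r₀) ≥ 2r₀+2p-2, while F(r₀)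
≤ F(r₀ - 1) ≤ F(2) + r₀ - 3. The case r₀ = 2 needs only F(2) ≥ 2p+3. For p = 5 an explicit graph
shows F(2) ≤ 16. -/

namespace Folkman

open Finset

/-! ### The arrow relation with natural-number colours -/

variable {V W : Type*}

/-- The relation `G → (2_r, p)` with colours in `ℕ`, all the colours `≥ r` being identified. -/
def Arr (G : SimpleGraph V) (r p : ℕ) : Prop :=
  ∀ c : V → ℕ, (∀ u v, G.Adj u v → c u = c v → r ≤ c u) →
    ∃ S : Finset V, G.IsNClique p S ∧ ∀ v ∈ S, r ≤ c v

theorem twos_get_of_lt {r p : ℕ} (i : Fin (twos r p).length) (h : i.1 < r) :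
    (twos r p).get i = 2 := by
  have : ∀ l (hl : l = List.replicate r 2 ++ [p]) (i : Fin l.length), i.1 < r → l.get i = 2 := by
    rintro _ rfl i h
    simp [h]
  exact this _ rfl i h

theorem twos_get_of_le {r p : ℕ} (i : Fin (twos r p).length) (h : r ≤ i.1) :
    (twos r p).get i = p := by
  have : ∀ l (hl : l = List.replicate r 2 ++ [p]) (i : Fin l.length), r ≤ i.1 → l.get i = p := by
    rintro _ rfl i h
    simp [List.getElem_append, Nat.not_lt.2 h]
  exact this _ rfl i h

theorem twos_length (r p : ℕ) : (twos r p).length = r + 1 := by simp [twos]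

theorem arrows_twos {G : SimpleGraph V} {r p : ℕ} : Arrows G (twos r p) ↔ Arr G r p := by
  classical
  constructor
  · intro h c hc
    obtain ⟨i, S, hS, hi⟩ := h fun v => ⟨min (c v) r, by rw [twos_length]; omega⟩
    have hi' : ∀ v ∈ S, min (c v) r = i.1 := fun v hv => congrArg Fin.val (hi v hv)
    rcases lt_or_ge i.1 r with hr | hr
    · rw [twos_get_of_lt i hr, SimpleGraph.isNClique_iff, Finset.card_eq_two] at hS
      obtain ⟨hS, u, v, huv, rfl⟩ := hS
      have h1 := hi' u (by simp)
      have h2 := hi' v (by simp)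
      have := hc u v (hS (by simp) (by simp) huv) (by omega)
      omega
    · rw [twos_get_of_le i hr] at hS
      exact ⟨S, hS, fun v hv => by have := hi' v hv; omega⟩
  · intro h c
    by_cases hc : ∀ u v, G.Adj u v → (c u).1 = (c v).1 → r ≤ (c u).1
    · obtain ⟨S, hS, hr⟩ := h (fun v => (c v).1) hc
      have hl := twos_length r p
      refine ⟨⟨r, by omega⟩, S, ?_, fun v hv => Fin.ext ?_⟩
      · rwa [twos_get_of_le _ le_rfl]
      · have := hr v hv
        have := (c v).2
        simp only
        omega
    · push Not at hc
      obtain ⟨u, v, huv, hc, hr⟩ := hc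
      refine ⟨c u, {u, v}, ?_, ?_⟩
      · rw [twos_get_of_lt _ hr]
        refine ⟨?_, Finset.card_pair huv.ne⟩
        simp [SimpleGraph.isClique_iff, Set.Pairwise, huv, huv.symm, huv.ne]
      · simp [Fin.ext_iff, hc]

theorem Arr.of_iso {G : SimpleGraph V} {H : SimpleGraph W} (e : G ≃g H) {r p : ℕ}
    (h : Arr G r p) : Arr H r p := by
  intro c hc
  obtain ⟨S, hS, hr⟩ := h (c ∘ e) fun u v huv => hc _ _ (e.map_adj_iff.2 huv)
  refine ⟨S.map e.toEquiv.toEmbedding, ?_, ?_⟩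
  · refine ⟨?_, by simpa using hS.card_eq⟩
    intro a ha b hb hab
    simp only [coe_map, Set.mem_image, mem_coe] at ha hb
    obtain ⟨a, ha, rfl⟩ := ha
    obtain ⟨b, hb, rfl⟩ := hb
    exact e.map_adj_iff.2 (hS.isClique ha hb fun h => hab (by rw [h]))
  · intro v hv
    obtain ⟨u, hu, rfl⟩ := Finset.mem_map.1 hv
    exact hr u hu

theorem cliqueNum_lt_iff [Fintype V] {G : SimpleGraph V} {q : ℕ} :
    G.cliqueNum < q ↔ G.CliqueFree q := by
  constructor
  · intro h S hS
    have := hS.isClique.card_le_cliqueNum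
    have := hS.card_eq
    omega
  · intro h
    by_contra hq
    obtain ⟨S, hS⟩ := G.exists_isNClique_cliqueNum
    exact h.mono (not_lt.1 hq) S hS

theorem card_mem_orders [Fintype V] {G : SimpleGraph V} {r p q : ℕ} (h : Arr G r p)
    (hq : G.CliqueFree q) : Fintype.card V ∈ orders (twos r p) q := by
  let e := Fintype.equivFin V
  refine ⟨G.map e.toEmbedding, arrows_twos.2 (h.of_iso (SimpleGraph.Iso.map e G)), ?_⟩
  rw [cliqueNum_lt_iff]
  exact hq.comap ⟨(SimpleGraph.Iso.map e G).symm.toCopy⟩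

theorem exists_of_mem_orders {r p q n : ℕ} (h : n ∈ orders (twos r p) q) :
    ∃ G : SimpleGraph (Fin n), Arr G r p ∧ G.CliqueFree q := by
  obtain ⟨G, h, hq⟩ := h
  exact ⟨G, arrows_twos.1 h, cliqueNum_lt_iff.1 hq⟩

/-! ### Removing and merging colour classes -/

/-- Deleting an independent set lowers the number of twos by one. -/
theorem Arr.delete {G : SimpleGraph V} {r p : ℕ} (h : Arr G (r + 1) p) {A : Set V}
    (hA : ∀ u ∈ A, ∀ v ∈ A, ¬ G.Adj u v) : Arr (G.induce Aᶜ) r p := by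
  classical
  intro c hc
  -- `A` becomes the extra class `r`; the old colours `≥ r` are pushed to `r + 1`.
  obtain ⟨S, hS, hr⟩ := h
    (fun v => if hv : v ∈ A then r else if c ⟨v, hv⟩ < r then c ⟨v, hv⟩ else r + 1) (by
    intro u v huv
    by_cases hu : u ∈ A <;> by_cases hv : v ∈ A
    · exact absurd huv (hA u hu v hv)
    · simp only [hu, hv, dif_pos, dif_neg, not_false_eq_true]
      split_ifs <;> omega
    · simp only [hu, hv, dif_pos, dif_neg, not_false_eq_true]
      split_ifs <;> omega
    · simp only [hu, hv, dif_neg, not_false_eq_true]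
      have := hc ⟨u, hu⟩ ⟨v, hv⟩ huv
      split_ifs <;> omega)
  have hSA : ∀ v ∈ S, ∃ hv : v ∉ A, r ≤ c ⟨v, hv⟩ := by
    intro v hv
    have := hr v hv
    split_ifs at this with h1 h2
    · omega
    · omega
    · exact ⟨h1, by omega⟩
  refine ⟨S.subtype (· ∈ Aᶜ), ⟨?_, ?_⟩, ?_⟩
  · intro a ha b hb hab
    rw [mem_coe, mem_subtype] at ha hb
    exact hS.isClique ha hb fun h => hab (Subtype.ext h)
  · rw [Finset.card_subtype, Finset.filter_true_of_mem, hS.card_eq]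
    exact fun v hv => (hSA v hv).1
  · intro v hv
    rw [mem_subtype] at hv
    exact (hSA v hv).2

/-- A colour class can be removed from the twos at the expense of one vertex of the clique. -/
theorem Arr.exists_clique_pred {G : SimpleGraph V} {r p : ℕ} (h : Arr G r p) (c : V → ℕ)
    (hc : ∀ u v, G.Adj u v → c u = c v → r + 1 ≤ c u) :
    ∃ S : Finset V, G.IsNClique (p - 1) S ∧ ∀ v ∈ S, r + 1 ≤ c v := by
  classical
  obtain ⟨S, hS, hr⟩ := h c fun u v huv hcc => by have := hc u v huv hcc; omega
  -- The class `r` is independent, so the clique loses at most one vertex to it.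
  have hcard : p - 1 ≤ #{v ∈ S | r + 1 ≤ c v} := by
    have h1 : #{v ∈ S | ¬ r + 1 ≤ c v} ≤ 1 := by
      refine Finset.card_le_one.2 fun a ha b hb => ?_
      simp only [mem_filter] at ha hb
      by_contra hab
      have := hr a ha.1
      have := hr b hb.1
      have := hc a b (hS.isClique ha.1 hb.1 hab) (by omega)
      omega
    have := Finset.card_filter_add_card_filter_not (s := S) (fun v => r + 1 ≤ c v)
    have := hS.card_eq
    omega
  obtain ⟨T, hT, hTc⟩ := Finset.exists_subset_card_eq hcard
  refine ⟨T, ⟨hS.isClique.subset ?_, hTc⟩, fun v hv => (mem_filter.1 (hT hv)).2⟩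
  exact_mod_cast hT.trans (filter_subset _ _)

/-- If the colour `i` is avoided then one needs one colour fewer. -/
theorem Arr.exists_clique_of_avoid {G : SimpleGraph V} {r p : ℕ} (h : Arr G r p) (c : V → ℕ)
    (hc : ∀ u v, G.Adj u v → c u = c v → r + 1 ≤ c u) {i : ℕ} (hi : i ≤ r)
    (hav : ∀ v, c v ≠ i) :
    ∃ S : Finset V, G.IsNClique p S ∧ ∀ v ∈ S, r + 1 ≤ c v := by
  -- The class `r` takes over the unused colour `i`.
  obtain ⟨S, hS, hr⟩ := h (fun v => if c v = r then i else c v) (by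
    intro u v huv hcc
    have := hav u
    have := hav v
    have := hc u v huv
    split_ifs at hcc ⊢ <;> omega)
  refine ⟨S, hS, fun v hv => ?_⟩
  have h1 := hr v hv
  have := hav v
  split_ifs at h1 <;> omega

theorem Arr.exists_nclique {G : SimpleGraph V} {r p : ℕ} (h : Arr G r p) :
    ∃ S : Finset V, G.IsNClique p S := by
  obtain ⟨S, hS, -⟩ := h (fun _ => r) (by simp)
  exact ⟨S, hS⟩

/-! ### Verified search: a graph on 16 vertices for p = 5 -/

section CliqueSearch

variable (G : SimpleGraph V) [DecidableRel G.Adj]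

/-- Does the list `l` contain a `k`-clique of `G` inside `P`? -/
def hasClique : List V → ℕ → (V → Bool) → Bool
  | _, 0, _ => true
  | [], _ + 1, _ => false
  | v :: l, k + 1, P =>
    (P v && hasClique l k fun w => P w && decide (G.Adj v w)) || hasClique l (k + 1) P

/-- Starting from the independent sets `A`, `B` and from `C`, is a 5-clique forced in the third
class, however the vertices of the list are distributed? -/
def forces : List V → List V → List V → List V → Bool
  | [], _, _, _ => false
  | v :: l, A, B, C =>
    (A.any (fun u => decide (G.Adj u v)) || forces l (v :: A) B C) &&
    (B.any (fun u => decide (G.Adj u v)) || forces l A (v :: B) C) &&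
    (hasClique G C 4 (fun u => decide (G.Adj u v)) || forces l A B (v :: C))

variable {G}

theorem exists_of_hasClique (l : List V) (k : ℕ) (P : V → Bool) (h : hasClique G l k P = true) :
    ∃ S : Finset V, G.IsNClique k S ∧ ∀ v ∈ S, v ∈ l ∧ P v = true := by
  classical
  induction l generalizing k P with
  | nil =>
    cases k with
    | zero => exact ⟨∅, by simp [SimpleGraph.isNClique_iff], by simp⟩
    | succ k => simp [hasClique] at h
  | cons v l ih =>
    cases k with
    | zero => exact ⟨∅, by simp [SimpleGraph.isNClique_iff], by simp⟩
    | succ k =>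
      simp only [hasClique, Bool.or_eq_true, Bool.and_eq_true] at h
      rcases h with ⟨hv, h⟩ | h
      · obtain ⟨S, hS, hl⟩ := ih _ _ h
        simp only [Bool.and_eq_true, decide_eq_true_eq] at hl
        refine ⟨insert v S, hS.insert fun b hb => (hl b hb).2.2, fun w hw => ?_⟩
        rcases Finset.mem_insert.1 hw with rfl | hw
        · exact ⟨by simp, hv⟩
        · exact ⟨by simp [(hl w hw).1], (hl w hw).2.1⟩
      · obtain ⟨S, hS, hl⟩ := ih _ _ h
        exact ⟨S, hS, fun w hw => ⟨by simp [(hl w hw).1], (hl w hw).2⟩⟩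

theorem hasClique_of_exists (l : List V) (k : ℕ) (P : V → Bool) (S : Finset V)
    (hS : G.IsNClique k S) (hl : ∀ v ∈ S, v ∈ l ∧ P v = true) : hasClique G l k P = true := by
  classical
  induction l generalizing k P S with
  | nil =>
    have : S = ∅ := Finset.eq_empty_of_forall_notMem fun v hv => by simpa using (hl v hv).1
    subst this
    obtain rfl : 0 = k := by simpa using hS.card_eq
    simp [hasClique]
  | cons v l ih =>
    cases k with
    | zero => simp [hasClique]
    | succ k =>
      simp only [hasClique, Bool.or_eq_true, Bool.and_eq_true]
      by_cases hv : v ∈ S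
      · refine Or.inl ⟨(hl v hv).2, ih _ _ (S.erase v) ⟨?_, ?_⟩ fun w hw => ?_⟩
        · exact hS.isClique.subset (by exact_mod_cast S.erase_subset v)
        · rw [Finset.card_erase_of_mem hv, hS.card_eq, Nat.add_sub_cancel]
        · obtain ⟨hwv, hw⟩ := Finset.mem_erase.1 hw
          have := hl w hw
          simp only [List.mem_cons, hwv, false_or] at this
          simp [this, hS.isClique hv hw hwv.symm]
      · refine Or.inr (ih _ _ S hS fun w hw => ?_)
        have := hl w hw
        rcases List.mem_cons.1 this.1 with rfl | h
        · exact absurd hw hv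
        · exact ⟨h, this.2⟩

theorem exists_of_forces (c : V → ℕ) (hc : ∀ u v, G.Adj u v → c u = c v → 2 ≤ c u)
    (l A B C : List V) (h : forces G l A B C = true)
    (hA : ∀ v ∈ A, c v = 0) (hB : ∀ v ∈ B, c v = 1) (hC : ∀ v ∈ C, 2 ≤ c v) :
    ∃ S : Finset V, G.IsNClique 5 S ∧ ∀ v ∈ S, 2 ≤ c v := by
  classical
  induction l generalizing A B C with
  | nil => simp [forces] at h
  | cons v l ih =>
    simp only [forces, Bool.or_eq_true, Bool.and_eq_true, List.any_eq_true,
      decide_eq_true_eq] at h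
    obtain ⟨⟨h0, h1⟩, h2⟩ := h
    obtain hv | hv | hv : c v = 0 ∨ c v = 1 ∨ 2 ≤ c v := by omega
    · rcases h0 with ⟨u, hu, huv⟩ | h0
      · have := hc u v huv (by rw [hA u hu, hv])
        have := hA u hu
        omega
      · exact ih _ _ _ h0 (by simpa [hv] using hA) hB hC
    · rcases h1 with ⟨u, hu, huv⟩ | h1
      · have := hc u v huv (by rw [hB u hu, hv])
        have := hB u hu
        omega
      · exact ih _ _ _ h1 hA (by simpa [hv] using hB) hC
    · rcases h2 with h2 | h2
      · obtain ⟨S, hS, hl⟩ := exists_of_hasClique _ _ _ h2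
        simp only [decide_eq_true_eq] at hl
        refine ⟨insert v S, hS.insert fun b hb => (hl b hb).2.symm, fun w hw => ?_⟩
        rcases Finset.mem_insert.1 hw with rfl | hw
        · exact hv
        · exact hC w (hl w hw).1
      · exact ih _ _ _ h2 hA hB (by simpa [hv] using hC)

end CliqueSearch

/-- The neighbourhoods of the vertices of `cayleyD8`, as bit masks. -/
def cayleyD8Mask (i : Fin 16) : ℕ :=
  [12270, 24285, 48315, 31095, 62190, 58845, 52155, 38775,
    61161, 56787, 48039, 30543, 61086, 56637, 47994, 30708].getD i.1 0

/-- A Cayley graph of the dihedral group of order 16. -/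
def cayleyD8 : SimpleGraph (Fin 16) where
  Adj i j := (cayleyD8Mask i).testBit j.1 = true
  symm := ⟨by decide +kernel⟩
  loopless := ⟨by decide +kernel⟩

instance : DecidableRel cayleyD8.Adj := fun i j =>
  inferInstanceAs (Decidable ((cayleyD8Mask i).testBit j.1 = true))

theorem cayleyD8_cliqueFree : cayleyD8.CliqueFree 6 := by
  intro S hS
  have h1 : hasClique cayleyD8 (List.finRange 16) 6 (fun _ => true) = false := by decide +kernel
  rw [hasClique_of_exists _ _ _ S hS (by simp)] at h1
  exact absurd h1 (by decide)

theorem cayleyD8_arr : Arr cayleyD8 2 5 := by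
  intro c hc
  have h : forces cayleyD8 (List.finRange 16) [] [] [] = true := by decide +kernel
  exact exists_of_forces c hc _ _ _ _ h (by simp) (by simp) (by simp)

theorem fv_two_two_five_le : Fv [2, 2, 5] 6 ≤ 16 := by
  have := card_mem_orders cayleyD8_arr cayleyD8_cliqueFree
  rw [Fintype.card_fin] at this
  exact Nat.sInf_le this

/-! ### Cones -/

/-- The graph `K₁ + G`. -/
def cone (G : SimpleGraph V) : SimpleGraph (Option V) where
  Adj a b := a ≠ b ∧ ∀ u v, a = some u → b = some v → G.Adj u v
  symm := ⟨fun _ _ h => ⟨h.1.symm, fun u v hu hv => (h.2 v u hv hu).symm⟩⟩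
  loopless := ⟨fun _ h => h.1 rfl⟩

theorem cone_adj_some {G : SimpleGraph V} {u v : V} :
    (cone G).Adj (some u) (some v) ↔ G.Adj u v := by
  constructor
  · exact fun h => h.2 u v rfl rfl
  · intro h
    refine ⟨by simpa using h.ne, ?_⟩
    rintro _ _ ⟨⟩ ⟨⟩
    exact h

theorem cone_adj_none {G : SimpleGraph V} {v : V} : (cone G).Adj none (some v) :=
  ⟨by simp, by simp⟩

theorem cone_isNClique_map {G : SimpleGraph V} {S : Finset V} {n : ℕ} (h : G.IsNClique n S) :
    (cone G).IsNClique n (S.map Function.Embedding.some) := by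
  refine ⟨?_, by rw [card_map, h.card_eq]⟩
  intro a ha b hb hab
  rw [mem_coe, mem_map] at ha hb
  obtain ⟨a, ha, rfl⟩ := ha
  obtain ⟨b, hb, rfl⟩ := hb
  exact cone_adj_some.2 (h.isClique ha hb fun h => hab (by rw [h]))

/-- If the apex has a large colour, it completes a `(p - 1)`-clique of `G`. Otherwise its colour is
avoided on all of `G`, which therefore has one class fewer to use. -/
theorem Arr.cone {G : SimpleGraph V} {r p : ℕ} (hp : 1 ≤ p) (h : Arr G r p) :
    Arr (cone G) (r + 1) p := by
  classical
  intro c hc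
  have hc' : ∀ u v, G.Adj u v → c (some u) = c (some v) → r + 1 ≤ c (some u) :=
    fun u v huv => hc _ _ (cone_adj_some.2 huv)
  rcases Nat.lt_or_ge r (c none) with hi | hi
  · obtain ⟨S, hS, hr⟩ := h.exists_clique_pred (fun v => c (some v)) hc'
    refine ⟨insert none (S.map Function.Embedding.some), ?_, ?_⟩
    · have := (cone_isNClique_map hS).insert (a := none) fun b hb => by
        obtain ⟨b, -, rfl⟩ := mem_map.1 hb
        exact cone_adj_none
      rwa [Nat.sub_add_cancel hp] at this
    · intro v hv
      rcases mem_insert.1 hv with rfl | hv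
      · exact hi
      · obtain ⟨v, hw, rfl⟩ := mem_map.1 hv
        exact hr v hw
  · obtain ⟨S, hS, hr⟩ := h.exists_clique_of_avoid (fun v => c (some v)) hc' hi fun v hv => by
      have := hc _ _ (cone_adj_none (G := G) (v := v)) hv.symm
      omega
    refine ⟨_, cone_isNClique_map hS, fun v hv => ?_⟩
    obtain ⟨v, hw, rfl⟩ := mem_map.1 hv
    exact hr v hw

theorem cone_cliqueFree {G : SimpleGraph V} {q : ℕ} (h : G.CliqueFree q) :
    (cone G).CliqueFree (q + 1) := by
  classical
  intro S hS
  have hcard : q ≤ #(eraseNone S) := by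
    rw [← card_map Function.Embedding.some, map_some_eraseNone]
    have := pred_card_le_card_erase (s := S) (a := none)
    rw [hS.card_eq] at this
    omega
  refine h.mono hcard (eraseNone S) ⟨?_, rfl⟩
  intro a ha b hb hab
  rw [mem_coe, mem_eraseNone] at ha hb
  exact cone_adj_some.1 (hS.isClique ha hb (by simpa using hab))

theorem succ_mem_orders {r p q n : ℕ} (hp : 1 ≤ p) (h : n ∈ orders (twos r p) q) :
    n + 1 ∈ orders (twos (r + 1) p) (q + 1) := by
  obtain ⟨G, hG, hq⟩ := exists_of_mem_orders h
  have := card_mem_orders (hG.cone hp) (cone_cliqueFree hq)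
  rwa [Fintype.card_option, Fintype.card_fin] at this

/-! ### Existence: adding a two without raising the clique number -/

section Amalgam

variable {U X κ : Type*}

/-- An independent set `X` together with one copy of `F` for every embedding `e : κ ↪ X`. In the
copy belonging to `e`, all the vertices of `K k` are joined to `e k`. -/
def amalgam (F : SimpleGraph U) (K : κ → Finset U) (X : Type*) :
    SimpleGraph (X ⊕ (κ ↪ X) × U) where
  Adj
    | .inl _, .inl _ => False
    | .inl x, .inr w => ∃ k, w.1 k = x ∧ w.2 ∈ K k
    | .inr w, .inl x => ∃ k, w.1 k = x ∧ w.2 ∈ K k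
    | .inr w, .inr w' => w.1 = w'.1 ∧ F.Adj w.2 w'.2
  symm := ⟨by
    rintro (x | w) (x' | w') h
    · exact h
    · exact h
    · exact h
    · exact ⟨h.1.symm, h.2.symm⟩⟩
  loopless := ⟨by
    rintro (x | w) h
    · exact h
    · exact F.loopless.irrefl _ h.2⟩

/-- A clique has at most one vertex in `X` and meets only one copy of `F`. Since `e` is injective, a
vertex of `X` sees in that copy only a single `K k`, of size at most `p - 1`. -/
theorem amalgam_cliqueFree {F : SimpleGraph U} {K : κ → Finset U} {p : ℕ} (hp : 2 ≤ p)
    (hF : F.CliqueFree (p + 1)) (hK : ∀ k, #(K k) ≤ p - 1) :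
    (amalgam F K X).CliqueFree (p + 1) := by
  classical
  intro S hS
  have hcard := hS.card_eq
  by_cases hx : ∃ x, Sum.inl x ∈ S
  · obtain ⟨x, hx⟩ := hx
    have hadj : ∀ w ∈ S.erase (Sum.inl x), (amalgam F K X).Adj (Sum.inl x) w := fun w hw =>
      hS.isClique hx (mem_of_mem_erase hw) (ne_of_mem_erase hw).symm
    have hcard' : #(S.erase (Sum.inl x)) = p := by
      rw [card_erase_of_mem hx, hcard, Nat.add_sub_cancel]
    obtain ⟨w, hw⟩ := card_pos.1 (show 0 < #(S.erase (Sum.inl x)) by omega)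
    have h1 := hadj w hw
    rcases w with x' | ⟨e, u⟩
    · exact h1
    obtain ⟨k, hk, -⟩ := h1
    have hsub : S.erase (Sum.inl x) ⊆ (K k).image fun u => Sum.inr (e, u) := by
      intro w' hw'
      have h2 := hadj w' hw'
      rcases w' with x' | ⟨e', u'⟩
      · exact h2.elim
      obtain rfl : e' = e := by
        by_contra hne
        exact hne (hS.isClique (mem_of_mem_erase hw') (mem_of_mem_erase hw) (by
          simp [hne])).1
      obtain ⟨k', hk', hu'⟩ := h2
      obtain rfl : k' = k := e'.injective (hk'.trans hk.symm)
      exact mem_image_of_mem _ hu'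
    have := (card_le_card hsub).trans card_image_le
    have := hK k
    omega
  · push Not at hx
    obtain ⟨w, hw⟩ := card_pos.1 (show 0 < #S by omega)
    rcases w with x' | ⟨e, u⟩
    · exact hx _ hw
    have hall : ∀ w ∈ S, ∃ u, w = Sum.inr (e, u) := by
      rintro (x' | ⟨e', u'⟩) hw'
      · exact (hx _ hw').elim
      by_cases hne : e' = e
      · exact ⟨u', by rw [hne]⟩
      · exact (hne (hS.isClique hw' hw (by simp [hne])).1).elim
    obtain ⟨T, hmem⟩ : ∃ T : Finset U, ∀ u, u ∈ T ↔ Sum.inr (e, u) ∈ S :=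
      ⟨S.preimage (fun u => Sum.inr (e, u)) (by intro a _ b _; simp), fun u => mem_preimage⟩
    have hT : S = T.image fun u => Sum.inr (e, u) := by
      ext w
      simp only [mem_image, hmem]
      constructor
      · intro h
        obtain ⟨u, rfl⟩ := hall w h
        exact ⟨u, h, rfl⟩
      · rintro ⟨u, h, rfl⟩
        exact h
    refine hF T ⟨?_, ?_⟩
    · intro a ha b hb hab
      rw [mem_coe, hmem] at ha hb
      exact (hS.isClique ha hb (by simpa using hab)).2
    · rw [← hcard, hT, card_image_of_injective]
      exact fun a b h => (Prod.ext_iff.1 (Sum.inr_injective h)).2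

/-- By pigeonhole, `X` contains the image of an embedding `e` on which the truncated colour is
constant. If that colour is small, the copy of `F` at `e` avoids it; if it is large, a suitable
point of `X` completes a `(p - 1)`-clique of the copy. -/
theorem amalgam_arr [Fintype U] {F : SimpleGraph U} {s p : ℕ} (hp : 2 ≤ p) (hF : Arr F s p) :
    Arr (amalgam F (fun k : {K : Finset U // #K ≤ p - 1} => k.1)
      (Fin ((s + 2) * Fintype.card {K : Finset U // #K ≤ p - 1}))) (s + 1) p := by
  classical
  set κ := {K : Finset U // #K ≤ p - 1}
  intro c hc
  obtain ⟨i, hi⟩ := Fintype.exists_le_card_fiber_of_mul_le_card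
    (fun x : Fin ((s + 2) * Fintype.card κ) =>
      (⟨min (c (Sum.inl x)) (s + 1), by omega⟩ : Fin (s + 2)))
    (n := Fintype.card κ) (by simp)
  rw [← Fintype.card_subtype] at hi
  obtain ⟨e'⟩ := Function.Embedding.nonempty_of_card_le hi
  let e := e'.trans (Function.Embedding.subtype _)
  have he : ∀ k, min (c (Sum.inl (e k))) (s + 1) = i.1 := fun k =>
    congrArg Fin.val (e' k).2
  have hc' : ∀ u v, F.Adj u v → c (Sum.inr (e, u)) = c (Sum.inr (e, v)) →
      s + 1 ≤ c (Sum.inr (e, u)) := fun u v huv => hc _ _ ⟨rfl, huv⟩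
  have hmap : ∀ {n : ℕ} {S : Finset U}, F.IsNClique n S →
      (amalgam F (fun k : κ => k.1) (Fin ((s + 2) * Fintype.card κ))).IsNClique n
        (S.image fun u => Sum.inr (e, u)) := by
    intro n S hS
    refine ⟨?_, ?_⟩
    · intro a ha b hb hab
      rw [mem_coe, mem_image] at ha hb
      obtain ⟨a, ha, rfl⟩ := ha
      obtain ⟨b, hb, rfl⟩ := hb
      exact ⟨rfl, hS.isClique ha hb fun h => hab (by rw [h])⟩
    · rw [card_image_of_injective, hS.card_eq]
      exact fun a b h => (Prod.ext_iff.1 (Sum.inr_injective h)).2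
  rcases Nat.lt_or_ge i.1 (s + 1) with h | h
  · obtain ⟨S, hS, hr⟩ := hF.exists_clique_of_avoid (fun u => c (Sum.inr (e, u))) hc'
      (Nat.lt_succ_iff.1 h) fun u hu => by
        -- Singletons are among the indices because `p ≥ 2`, so every vertex of the copy has a
        -- neighbour of colour `i` in `X`.
        have h1 := he ⟨{u}, by rw [card_singleton]; omega⟩
        have := hc (Sum.inl (e ⟨{u}, by rw [card_singleton]; omega⟩)) (Sum.inr (e, u))
          ⟨_, rfl, mem_singleton_self u⟩ (by omega)
        omega
    refine ⟨_, hmap hS, fun v hv => ?_⟩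
    obtain ⟨v, hw, rfl⟩ := mem_image.1 hv
    exact hr v hw
  · obtain ⟨S, hS, hr⟩ := hF.exists_clique_pred (fun u => c (Sum.inr (e, u))) hc'
    have hins := (hmap hS).insert (a := Sum.inl (e ⟨S, hS.card_eq.le⟩)) fun b hb => by
      obtain ⟨b, hw, rfl⟩ := mem_image.1 hb
      exact ⟨_, rfl, hw⟩
    rw [Nat.sub_add_cancel (by omega)] at hins
    refine ⟨_, hins, fun v hv => ?_⟩
    rcases mem_insert.1 hv with rfl | hv
    · have := he ⟨S, hS.card_eq.le⟩
      omega
    · obtain ⟨v, hw, rfl⟩ := mem_image.1 hv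
      exact hr v hw

end Amalgam

theorem orders_nonempty_of_two_le {p : ℕ} (hp : 2 ≤ p) (s : ℕ) :
    (orders (twos s p) (p + 1)).Nonempty := by
  classical
  induction s with
  | zero =>
    refine ⟨_, card_mem_orders (G := (⊤ : SimpleGraph (Fin p))) (fun c _ => ?_) fun S hS => ?_⟩
    · exact ⟨univ, ⟨fun a _ b _ h => h, by simp⟩, by simp⟩
    · have := card_le_univ S
      rw [hS.card_eq, Fintype.card_fin] at this
      omega
  | succ s ih =>
    obtain ⟨n, hn⟩ := ih
    obtain ⟨F, hF, hq⟩ := exists_of_mem_orders hn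
    exact ⟨_, card_mem_orders (amalgam_arr hp hF) (amalgam_cliqueFree hp hq fun k => k.2)⟩

theorem orders_nonempty {r p : ℕ} (hp : 2 ≤ p) (hr : 2 ≤ r) :
    (orders (twos r p) (r + p - 1)).Nonempty := by
  obtain ⟨n, hn⟩ := orders_nonempty_of_two_le hp r
  obtain ⟨G, hG, hq⟩ := exists_of_mem_orders hn
  exact ⟨_, card_mem_orders hG (hq.mono (by omega))⟩

/-! ### Matchings by non-edges and lower bounds for the order -/

/-- If no vertex lies in all the maximum cliques, then a maximum clique is matched into the rest
of the graph by non-edges. -/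
theorem exists_matching_of_cliques [Fintype V] {G : SimpleGraph V} {k : ℕ}
    (hfree : G.CliqueFree (k + 1)) (hcore : ∀ v, ∃ S : Finset V, G.IsNClique k S ∧ v ∉ S)
    {S : Finset V} (hS : G.IsNClique k S) :
    ∃ f : S → V, Function.Injective f ∧ ∀ s : S, f s ∉ S ∧ ¬ G.Adj s (f s) := by
  classical
  let t : V → Finset V := fun s => {w | w ≠ s ∧ ¬ G.Adj s w}
  have ht : ∀ {s w}, w ∈ t s ↔ w ≠ s ∧ ¬ G.Adj s w := by simp [t]
  -- Hall's condition for the non-neighbour sets, by induction on the clique `B`: a `k`-clique `X`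
  -- missing some vertex of `B` makes `B ∩ X` smaller.
  have key : ∀ B : Finset V, G.IsClique B → #B ≤ #(B.biUnion t) := by
    intro B
    induction B using Finset.strongInduction with
    | H B ih =>
      intro hB
      rcases B.eq_empty_or_nonempty with rfl | ⟨b, hb⟩
      · simp
      obtain ⟨X, hX, hbX⟩ := hcore b
      have h1 : #(B ∩ X) ≤ #((B ∩ X).biUnion t) := by
        refine ih _ ⟨inter_subset_left, fun h => hbX (mem_inter.1 (h hb)).2⟩
          (hB.subset ?_)
        exact_mod_cast inter_subset_left
      -- Exchange: replacing the non-neighbours of `B \ X` in `X` by `B \ X` itself gives a clique,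
      -- which cannot exceed `k` vertices.
      have h2 : #(B \ X) ≤ #((B \ X).biUnion t ∩ X) := by
        by_contra hlt
        have hdisj : Disjoint (B \ X) (X \ (B \ X).biUnion t) :=
          disjoint_sdiff_self_left.mono_right sdiff_subset
        refine hfree.mono (?_ : k + 1 ≤ #((B \ X) ∪ (X \ (B \ X).biUnion t))) _ ⟨?_, rfl⟩
        · rw [card_union_of_disjoint hdisj]
          have := card_inter_add_card_sdiff X ((B \ X).biUnion t)
          rw [inter_comm, hX.card_eq] at this
          omega
        · have hcross : ∀ a ∈ B \ X, ∀ x ∈ X \ (B \ X).biUnion t, G.Adj a x := by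
            intro a ha x hx
            rw [mem_sdiff] at hx
            by_contra hax
            refine hx.2 (mem_biUnion.2 ⟨a, ha, ht.2 ⟨?_, hax⟩⟩)
            rintro rfl
            exact (mem_sdiff.1 ha).2 hx.1
          intro a ha c hc hac
          rw [mem_coe, mem_union] at ha hc
          rcases ha with ha | ha <;> rcases hc with hc | hc
          · exact hB (mem_sdiff.1 ha).1 (mem_sdiff.1 hc).1 hac
          · exact hcross a ha c hc
          · exact (hcross c hc a ha).symm
          · exact hX.isClique (mem_sdiff.1 ha).1 (mem_sdiff.1 hc).1 hac
      -- Vertices of the clique `X` have their non-neighbours outside `X`.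
      have hdisj : Disjoint ((B ∩ X).biUnion t) ((B \ X).biUnion t ∩ X) := by
        rw [Finset.disjoint_left]
        intro w hw hw'
        obtain ⟨x, hx, hxw⟩ := mem_biUnion.1 hw
        rw [ht] at hxw
        exact hxw.2 (hX.isClique (mem_inter.1 hx).2 (mem_inter.1 hw').2 hxw.1.symm)
      calc #B = #(B ∩ X) + #(B \ X) := (card_inter_add_card_sdiff B X).symm
        _ ≤ #((B ∩ X).biUnion t) + #((B \ X).biUnion t ∩ X) := add_le_add h1 h2
        _ = #((B ∩ X).biUnion t ∪ ((B \ X).biUnion t ∩ X)) := (card_union_of_disjoint hdisj).symm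
        _ ≤ #(B.biUnion t) := card_le_card (union_subset
            (biUnion_subset_biUnion_of_subset_left t inter_subset_left)
            (inter_subset_left.trans (biUnion_subset_biUnion_of_subset_left t sdiff_subset)))
  obtain ⟨f, hf, hft⟩ := (Finset.all_card_le_biUnion_card_iff_exists_injective
    (fun s : S => t s)).1 fun B => by
      have h := key (B.map (Function.Embedding.subtype _)) (hS.isClique.subset (by
        intro x hx
        obtain ⟨y, -, rfl⟩ := mem_map.1 (mem_coe.1 hx)
        exact y.2))
      rw [card_map] at h
      refine h.trans (card_le_card ?_)
      intro w hw
      obtain ⟨x, hx, hxw⟩ := mem_biUnion.1 hw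
      obtain ⟨y, hy, rfl⟩ := mem_map.1 hx
      exact mem_biUnion.2 ⟨y, hy, hxw⟩
  refine ⟨f, hf, fun s => ?_⟩
  have h := ht.1 (hft s)
  exact ⟨fun hs => h.2 (hS.isClique s.2 hs h.1.symm), h.2⟩

/-- Colour `k` disjoint non-adjacent pairs by `0, …, k - 1` and everything else by `k`. The forced
`p`-clique takes at most one vertex from each of the `k - r` pairs of colour `≥ r`, and the rest
from the `|V| - 2k` unpaired vertices. -/
theorem Arr.card_ge [Fintype V] {G : SimpleGraph V} {k r p : ℕ} (hfree : G.CliqueFree (k + 1))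
    (h1 : Arr G 1 k) (h : Arr G r p) (hr : r ≤ k) : p + r + k ≤ Fintype.card V := by
  classical
  obtain ⟨S, hS⟩ := h1.exists_nclique
  -- Making `{v}` the independent class forces a `k`-clique that misses `v`.
  obtain ⟨f, hf, hfS⟩ := exists_matching_of_cliques hfree (fun v => by
    obtain ⟨S, hS, hSv⟩ := h1 (fun w => if w = v then 0 else 1) (by
      intro a b hab
      have := hab.ne
      split_ifs <;> simp_all)
    exact ⟨S, hS, fun hv => by simpa using hSv v hv⟩) hS
  let e := (S.equivFinOfCardEq hS.card_eq).symm
  let s : Fin k → V := fun i => e i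
  let g : Fin k → V := fun i => f (e i)
  have hs : Function.Injective s := Subtype.val_injective.comp e.injective
  have hg : Function.Injective g := hf.comp e.injective
  have hsg : ∀ i j, s i ≠ g j := fun i j hij => (hfS (e j)).1 (show g j ∈ S from hij ▸ (e i).2)
  have hadj : ∀ i, ¬ G.Adj (s i) (g i) := fun i => (hfS (e i)).2
  have hex : ∀ v, ∃ m : ℕ, (∃ i : Fin k, m = i ∧ (v = s i ∨ v = g i)) ∨
      (m = k ∧ ∀ i, v ≠ s i ∧ v ≠ g i) := by
    intro v
    by_cases hv : ∃ i, v = s i ∨ v = g i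
    · obtain ⟨i, hi⟩ := hv
      exact ⟨i, Or.inl ⟨i, rfl, hi⟩⟩
    · push Not at hv
      exact ⟨k, Or.inr ⟨rfl, hv⟩⟩
  choose c hc using hex
  have hproper : ∀ u v, G.Adj u v → c u = c v → k ≤ c u := by
    intro u v huv huv'
    rcases hc u with ⟨i, hi, hu⟩ | ⟨hi, -⟩
    · rcases hc v with ⟨j, hj, hv⟩ | ⟨hj, -⟩
      · obtain rfl : i = j := Fin.ext (by omega)
        rcases hu with rfl | rfl <;> rcases hv with rfl | rfl
        · exact (huv.ne rfl).elim
        · exact (hadj _ huv).elim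
        · exact (hadj _ huv.symm).elim
        · exact (huv.ne rfl).elim
      · omega
    · omega
  obtain ⟨T, hT, hTc⟩ := h c fun u v huv huv' => hr.trans (hproper u v huv huv')
  have hlow : #{v ∈ T | c v < k} ≤ k - r := by
    rw [← Nat.card_Ico]
    refine card_le_card_of_injOn c ?_ ?_
    · intro v hv
      simp only [coe_filter, Set.mem_ofPred_eq] at hv
      simpa using ⟨hTc v hv.1, hv.2⟩
    · intro u hu v hv huv
      simp only [coe_filter, Set.mem_ofPred_eq] at hu hv
      by_contra hne
      have := hproper u v (hT.isClique hu.1 hv.1 hne) huv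
      omega
  have hinj : Function.Injective (Sum.elim s g) := hs.sumElim hg hsg
  have hhigh : #{v ∈ T | ¬ c v < k} ≤ Fintype.card V - (k + k) := by
    have himg : #(univ.image (Sum.elim s g)) = k + k := by
      rw [card_image_of_injective _ hinj]
      simp
    rw [← himg, ← card_compl]
    refine card_le_card fun v hv => ?_
    rw [mem_compl, mem_image]
    rintro ⟨i | i, -, rfl⟩
    · rcases hc (s i) with ⟨j, hj, -⟩ | ⟨-, hj⟩
      · exact (mem_filter.1 hv).2 (hj ▸ j.2 : c (s i) < k)
      · exact (hj i).1 rfl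
    · rcases hc (g i) with ⟨j, hj, -⟩ | ⟨-, hj⟩
      · exact (mem_filter.1 hv).2 (hj ▸ j.2 : c (g i) < k)
      · exact (hj i).2 rfl
  have hcard := Fintype.card_le_of_injective _ hinj
  rw [Fintype.card_sum, Fintype.card_fin] at hcard
  have := card_filter_add_card_filter_not (s := T) (fun v => c v < k)
  have := hT.card_eq
  omega

theorem Arr.of_succ {G : SimpleGraph V} {r p : ℕ} (h : Arr G (r + 1) p) : Arr G r p := by
  intro c hc
  obtain ⟨S, hS, hr⟩ := h (fun v => if c v < r then c v else r + 1) (by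
    intro u v huv
    have := hc u v huv
    split_ifs <;> omega)
  refine ⟨S, hS, fun v hv => ?_⟩
  have := hr v hv
  split_ifs at this <;> omega

theorem Arr.lt_card [Fintype V] {G : SimpleGraph V} {r p : ℕ} (hp : 1 ≤ p) (h : Arr G r p) :
    r < Fintype.card V := by
  obtain ⟨S, hS, hr⟩ := h (fun v => Fintype.equivFin V v) (by
    intro u v huv huv'
    exact (huv.ne ((Fintype.equivFin V).injective (Fin.ext huv'))).elim)
  obtain ⟨v, hv⟩ := card_pos.1 (show 0 < #S by rw [hS.card_eq]; omega)
  have := hr v hv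
  omega

theorem induce_cliqueFree {G : SimpleGraph V} {q : ℕ} (h : G.CliqueFree q) (A : Set V) :
    (G.induce A).CliqueFree q :=
  h.comap ⟨(SimpleGraph.Embedding.induce A).toCopy⟩

/-- Deleting a non-adjacent pair costs one two, and `Arr.card_ge` still gives `2 * p + 1` remaining
vertices. -/
theorem Arr.two_mul_add_three_le [Fintype V] {G : SimpleGraph V} {p : ℕ} (hp : 1 ≤ p)
    (hfree : G.CliqueFree (p + 1)) (h : Arr G 2 p) : 2 * p + 3 ≤ Fintype.card V := by
  classical
  have hcard := h.of_succ.card_ge hfree h.of_succ hp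
  obtain ⟨u, v, huv, hadj⟩ : ∃ u v, u ≠ v ∧ ¬ G.Adj u v := by
    by_contra! hall
    refine hfree.mono (?_ : p + 1 ≤ #(univ : Finset V)) univ ⟨fun a _ b _ => hall a b, rfl⟩
    rw [card_univ]
    omega
  have hdel : Arr (G.induce ({u, v} : Set V)ᶜ) 1 p := h.delete (by
    simp [hadj, G.adj_comm v u])
  have := hdel.card_ge (induce_cliqueFree hfree _) hdel hp
  rw [Fintype.card_compl_set] at this
  simp [huv] at this
  omega

/-! ### The sequence of Folkman numbers and its first minimizer -/

theorem fv_mem {r p : ℕ} (hp : 2 ≤ p) (hr : 2 ≤ r) :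
    Fv (twos r p) (r + p - 1) ∈ orders (twos r p) (r + p - 1) :=
  Nat.sInf_mem (orders_nonempty hp hr)

theorem fv_succ_le {r p : ℕ} (hp : 2 ≤ p) (hr : 2 ≤ r) :
    Fv (twos (r + 1) p) (r + 1 + p - 1) ≤ Fv (twos r p) (r + p - 1) + 1 := by
  have h := succ_mem_orders (by omega) (fv_mem hp hr)
  rw [show r + p - 1 + 1 = r + 1 + p - 1 by omega] at h
  exact Nat.sInf_le h

theorem fv_add_le {r p : ℕ} (hp : 2 ≤ p) (hr : 2 ≤ r) {s : ℕ} (hs : r ≤ s) :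
    Fv (twos s p) (s + p - 1) + r ≤ Fv (twos r p) (r + p - 1) + s := by
  induction s, hs using Nat.le_induction with
  | base => exact le_rfl
  | succ s hs ih =>
    have := fv_succ_le hp (hr.trans hs)
    omega

theorem lt_fv {r p : ℕ} (hp : 2 ≤ p) (hr : 2 ≤ r) : r < Fv (twos r p) (r + p - 1) := by
  obtain ⟨G, hG, -⟩ := exists_of_mem_orders (fv_mem hp hr)
  simpa using hG.lt_card (by omega)

theorem mem_minimizers {r p : ℕ} : r ∈ minimizers p ↔ 2 ≤ r ∧ ∀ s : ℕ, 2 ≤ s →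
    (Fv (twos r p) (r + p - 1) : ℤ) - r ≤ (Fv (twos s p) (s + p - 1) : ℤ) - s := by
  constructor
  · exact fun h => ⟨h.1, fun s hs => h.2.2 ⟨s, hs, rfl⟩⟩
  · refine fun h => ⟨h.1, ⟨r, h.1, rfl⟩, ?_⟩
    rintro _ ⟨s, hs, rfl⟩
    exact h.2 s hs

theorem minimizers_nonempty {p : ℕ} (hp : 2 ≤ p) : (minimizers p).Nonempty := by
  have hne : {m | ∃ r, 2 ≤ r ∧ Fv (twos r p) (r + p - 1) = r + m}.Nonempty :=
    ⟨Fv (twos 2 p) (2 + p - 1) - 2, 2, le_rfl, by have := lt_fv hp (le_refl 2); omega⟩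
  obtain ⟨r, hr, h⟩ := Nat.sInf_mem hne
  refine ⟨r, mem_minimizers.2 ⟨hr, fun s hs => ?_⟩⟩
  have hs' := lt_fv hp hs
  have := Nat.sInf_le (s := {m | ∃ r, 2 ≤ r ∧ Fv (twos r p) (r + p - 1) = r + m})
    (m := Fv (twos s p) (s + p - 1) - s) ⟨s, hs, by omega⟩
  omega

theorem isLeast_r₀ {p : ℕ} (hp : 2 ≤ p) : IsLeast (minimizers p) (r₀ p) :=
  ⟨Nat.sInf_mem (minimizers_nonempty hp), fun _ h => Nat.sInf_le h⟩

/-- Since `r` is not a minimizer, F(r) - r strictly exceeds the minimum F(r+1) - (r+1). -/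
theorem fv_pred_r₀ {p r : ℕ} (hp : 2 ≤ p) (hr : 2 ≤ r) (h : r₀ p = r + 1) :
    Fv (twos (r + 1) p) (r + 1 + p - 1) ≤ Fv (twos r p) (r + p - 1) := by
  by_contra hlt
  obtain ⟨hmem, hleast⟩ := isLeast_r₀ hp
  rw [h] at hmem hleast
  have h' := (mem_minimizers.1 hmem).2
  have := hleast (mem_minimizers.2 ⟨hr, fun s hs => by have := h' s hs; omega⟩ : r ∈ minimizers p)
  omega

theorem arr_of_isExtremal {p : ℕ} (hp : 2 ≤ p) (h₀ : 2 < r₀ p) {V : Type*} [Fintype V]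
    {G : SimpleGraph V} (hG : IsExtremal G (twos (r₀ p) p) (r₀ p + p - 1)) :
    Arr G 1 (r₀ p + p - 2) := by
  classical
  obtain ⟨r, hr⟩ : ∃ r, r₀ p = r + 1 := ⟨r₀ p - 1, by omega⟩
  obtain ⟨⟨harr, -⟩, hcard⟩ := hG
  rw [arrows_twos] at harr
  have hpred := fv_pred_r₀ hp (by omega) hr
  rw [hr] at harr hcard ⊢
  by_contra hnot
  simp only [Arr] at hnot
  push Not at hnot
  obtain ⟨c, hc, hno⟩ := hnot
  have hpos : 0 < Fintype.card V := (Nat.zero_le _).trans_lt (harr.lt_card (by omega))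
  -- `A` is the class of colour 0, or any single vertex if that class is empty: it must be nonempty
  -- for the order to drop.
  obtain ⟨A, ⟨a, ha⟩, hA, hfree⟩ : ∃ A : Set V, A.Nonempty ∧ (∀ u ∈ A, ∀ v ∈ A, ¬ G.Adj u v) ∧
      ∀ v, c v = 0 → v ∈ A := by
    by_cases h0 : ∃ v, c v = 0
    · refine ⟨{v | c v = 0}, h0, fun u hu v hv huv => ?_, fun v hv => hv⟩
      have h1 : c u = 0 := hu
      have h2 : c v = 0 := hv
      have := hc u v huv (by omega)
      omega
    · push Not at h0
      obtain ⟨v⟩ := Fintype.card_pos_iff.1 hpos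
      exact ⟨{v}, ⟨v, rfl⟩, by simp, fun w hw => (h0 w hw).elim⟩
  have hle : Fintype.card ↥Aᶜ ∈ orders (twos r p) (r + p - 1) := by
    refine card_mem_orders (harr.delete hA) fun S hS => ?_
    have hS' : G.IsNClique (r + 1 + p - 2) (S.map (Function.Embedding.subtype _)) := by
      refine ⟨fun x hx y hy hxy => ?_, ?_⟩
      · obtain ⟨x, hx', rfl⟩ := Finset.mem_map.1 (Finset.mem_coe.1 hx)
        obtain ⟨y, hy', rfl⟩ := Finset.mem_map.1 (Finset.mem_coe.1 hy)
        exact hS.isClique hx' hy' fun h => hxy (by rw [h])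
      · rw [Finset.card_map, hS.card_eq]
        omega
    obtain ⟨v, hv, hv'⟩ := hno _ hS'
    obtain ⟨w, -, rfl⟩ := Finset.mem_map.1 hv
    exact w.2 (hfree _ (Nat.lt_one_iff.1 hv'))
  have hle' : Fv (twos r p) (r + p - 1) ≤ Fintype.card ↥Aᶜ := Nat.sInf_le hle
  have hlt : Fintype.card ↥Aᶜ < Fintype.card V :=
    Fintype.card_subtype_lt (x := a) fun h => h ha
  omega

theorem r₀_add_two_mul_lt {p : ℕ} (hp : 2 ≤ p) : r₀ p + 2 * p < Fv (twos 2 p) (2 + p - 1) := by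
  have h2 := (isLeast_r₀ hp).1.1
  rcases h2.eq_or_lt with h | h
  · obtain ⟨G, hG, hq⟩ := exists_of_mem_orders (fv_mem hp (le_refl 2))
    have := hG.two_mul_add_three_le (by omega) (hq.mono (by omega))
    rw [Fintype.card_fin] at this
    omega
  · obtain ⟨r, hr⟩ : ∃ r, r₀ p = r + 1 := ⟨r₀ p - 1, by omega⟩
    obtain ⟨G, hG⟩ := fv_mem hp h2
    have h1 := arr_of_isExtremal hp h ⟨hG, Fintype.card_fin _⟩
    have hcard := h1.card_ge ((cliqueNum_lt_iff.1 hG.2).mono (by omega)) (arrows_twos.1 hG.1)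
      (by omega)
    rw [Fintype.card_fin] at hcard
    have hpred := fv_pred_r₀ hp (by omega) hr
    have := fv_add_le hp (le_refl 2) (s := r) (by omega)
    rw [hr] at hcard
    omega

end Folkman

theorem mainTheorem11 :
    (∀ p : ℕ, 2 ≤ p →
      -- the Folkman numbers involved exist, and `r₀ p` is well defined
      (∀ r : ℕ, 2 ≤ r → (Folkman.orders (Folkman.twos r p) (r + p - 1)).Nonempty) ∧
      IsLeast (Folkman.minimizers p) (Folkman.r₀ p) ∧
      -- (a)
      (∀ r : ℕ, Folkman.r₀ p ≤ r →
        (Folkman.Fv (Folkman.twos r p) (r + p - 1) : ℤ) =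
          Folkman.Fv (Folkman.twos (Folkman.r₀ p) p) (Folkman.r₀ p + p - 1)
            + r - Folkman.r₀ p) ∧
      -- (b)
      (Folkman.r₀ p = 2 → ∀ r : ℕ, 2 ≤ r →
        (Folkman.Fv (Folkman.twos r p) (r + p - 1) : ℤ) =
          Folkman.Fv [2, 2, p] (p + 1) + r - 2) ∧
      -- (c)
      (2 < Folkman.r₀ p → ∀ (V : Type*) [Fintype V] (G : SimpleGraph V),
        Folkman.IsExtremal G (Folkman.twos (Folkman.r₀ p) p) (Folkman.r₀ p + p - 1) →
        Folkman.Arrows G [2, Folkman.r₀ p + p - 2]) ∧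
      -- (d)
      (Folkman.r₀ p : ℤ) < (Folkman.Fv [2, 2, p] (p + 1) : ℤ) - 2 * p) ∧
    Folkman.r₀ 5 ≤ 5 := by
  have htwo : ∀ p, Folkman.Fv (Folkman.twos 2 p) (2 + p - 1) = Folkman.Fv [2, 2, p] (p + 1) :=
    fun p => by rw [show 2 + p - 1 = p + 1 by omega]; rfl
  refine ⟨fun p hp => ?_, ?_⟩
  · have hr := Folkman.isLeast_r₀ hp
    have hmin := Folkman.mem_minimizers.1 hr.1
    have ha : ∀ r : ℕ, Folkman.r₀ p ≤ r → (Folkman.Fv (Folkman.twos r p) (r + p - 1) : ℤ) =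
        Folkman.Fv (Folkman.twos (Folkman.r₀ p) p) (Folkman.r₀ p + p - 1)
          + r - Folkman.r₀ p := fun r h => by
      have := hmin.2 r (hmin.1.trans h)
      have := Folkman.fv_add_le hp hmin.1 h
      omega
    refine ⟨fun r h => Folkman.orders_nonempty hp h, hr, ha, fun h2 r h => ?_,
      fun h V _ G hG => Folkman.arrows_twos.2 (Folkman.arr_of_isExtremal hp h hG), ?_⟩
    · have := ha r (h2 ▸ h)
      rw [h2, htwo] at this
      exact this
    · have := Folkman.r₀_add_two_mul_lt hp
      rw [htwo] at this
      omega
  · have := Folkman.r₀_add_two_mul_lt (p := 5) (by norm_num)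
    rw [htwo] at this
    have h16 : Folkman.Fv [2, 2, 5] (5 + 1) ≤ 16 := Folkman.fv_two_two_five_le
    omega
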